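/- A \emph{bilateral birth--and--death process} with birth rates $\lambda_n$ and death rates $\mu_n$ ($n\in\mathbb Z$, all positive) is a time-homogeneous Markov process $X_t$, $t\ge 0$, on $\mathbb Z$ whose transition probabilities $p_{k,n}(t)=\Pr\{X_t=n\mid X_0=k\}$ are nonnegative, satisfy $\sum_n p_{k,n}(t)\le 1$ (a defect being the probability that the process has exploded before time $t$), $p_{k,n}(0)=\delta_{k,n}$ and the Chapman--Kolmogorov equations $p_{k,n}(s+t)=\sum_j p_{k,j}(s)\,p_{j,n}(t)$, and for which, as $\delta\downarrow 0$, $$\frac{p_{n,n+1}(\delta)}{\delta}\to\lambda_n,\qquad \frac{p_{n,n-1}(\delta)}{\delta}\to\mu_n,\qquad \frac{1-p_{n,n}(\delta)}{\delta}\to\lambda_n+\mu_n .$$ The process is \emph{simple} if its rates determine its transition probabilities uniquely. \textbf{Theorem.} Let $X_t$ be a simple bilateral birth--and--death process on $\mathbb Z$ with positive rates $\lambda_n,\mu_n$ and transition probabilities $p_{k,n}(t)$. Let $(\nu_n)_{n\in\mathbb Z}$ be a strictly monotonic (increasing or decreasing) sequence of positive numbers with $$\nu_{n+1}\lambda_n-\nu_n(\lambda_n+\mu_n)+\nu_{n-1}\mu_n=0\qquad(n\in\mathbb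 Z),$$ and put $$\widetilde\lambda_n=\lambda_n\frac{\nu_{n+1}}{\nu_n},\qquad \widetilde\mu_n=\mu_n\frac{\nu_{n-1}}{\nu_n}\qquad(n\in\mathbb Z).$$ Then the functions $\frac{\nu_n}{\nu_k}\,p_{k,n}(t)$ are the transition probabilities of a bilateral birth--and--death process with rates $\widetilde\lambda_n,\widetilde\mu_n$. Moreover, if $\widetilde X_t$ is a simple bilateral birth--and--death process with rates $\widetilde\lambda_n,\widetilde\mu_n$, then its transition probabilities are $$\widetilde p_{k,n}(t)=\frac{\nu_n}{\nu_k}\,p_{k,n}(t)\qquad(k,n\in\mathbb Z,\ t\ge 0).$$ -/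

import Mathlib

open Filter Topology

/-- `p t k n` (for `t ≥ 0`) are the transition probabilities `Pr{X_t = n | X_0 = k}` of a
time-homogeneous Markov process on `ℤ` which is a birth-and-death process with birth rates `lam n`
and death rates `mu n`.

As usual for Markov chains in continuous time, row sums are only required to be at most `1`: a
defect is the probability that the process has exploded (left `ℤ`) before time `t`. The last three
fields say that, as `δ ↓ 0`, the process moves from `n` to `n + 1` with probability
`lam n * δ + o(δ)`, to `n - 1` with probability `mu n * δ + o(δ)`, and that everything else apart
from staying at `n` has probability `o(δ)`. Values at negative times are irrelevant. -/
structure IsBirthDeathTransition (lam mu : ℤ → ℝ) (p : ℝ → ℤ → ℤ → ℝ) : Prop where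
  nonneg : ∀ t : ℝ, 0 ≤ t → ∀ k n : ℤ, 0 ≤ p t k n
  summable_row : ∀ t : ℝ, 0 ≤ t → ∀ k : ℤ, Summable fun n : ℤ => p t k n
  row_le_one : ∀ t : ℝ, 0 ≤ t → ∀ k : ℤ, ∑' n : ℤ, p t k n ≤ 1
  initial : ∀ k n : ℤ, p 0 k n = if n = k then 1 else 0
  chapman_kolmogorov : ∀ s t : ℝ, 0 ≤ s → 0 ≤ t → ∀ k n : ℤ,
    HasSum (fun j : ℤ => p s k j * p t j n) (p (s + t) k n)
  birth_rate : ∀ n : ℤ, Tendsto (fun δ : ℝ => p δ n (n + 1) / δ) (𝓝[>] 0) (𝓝 (lam n))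
  death_rate : ∀ n : ℤ, Tendsto (fun δ : ℝ => p δ n (n - 1) / δ) (𝓝[>] 0) (𝓝 (mu n))
  exit_rate : ∀ n : ℤ, Tendsto (fun δ : ℝ => (1 - p δ n n) / δ) (𝓝[>] 0) (𝓝 (lam n + mu n))

/-- The birth-and-death process with rates `lam`, `mu` is simple: the rates determine the
process, that is, its transition probabilities, uniquely. -/
def IsSimpleBirthDeath (lam mu : ℤ → ℝ) : Prop :=
  ∀ p q : ℝ → ℤ → ℤ → ℝ, IsBirthDeathTransition lam mu p → IsBirthDeathTransition lam mu q →
    ∀ t : ℝ, 0 ≤ t → ∀ k n : ℤ, p t k n = q t k n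

/-- Birth rates of the transformed process. -/
noncomputable def transformedBirth (lam nu : ℤ → ℝ) (n : ℤ) : ℝ := lam n * (nu (n + 1) / nu n)

/-- Death rates of the transformed process. -/
noncomputable def transformedDeath (mu nu : ℤ → ℝ) (n : ℤ) : ℝ := mu n * (nu (n - 1) / nu n)

/-! Minimality is compatible with Doob transforms. If `D` is the diagonal matrix of `nu` and `Q` is
the generator of the process, harmonicity of `nu` says exactly that `D⁻¹ Q D` is the generator with
the transformed rates. The minimal transition function of a generator is the supremum of the
exponentials `exp (t Q_S)` of its finite truncations, and `exp (t D⁻¹ Q_S D) = D⁻¹ exp (t Q_S) D`.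
Hence `nu n / nu k` times the minimal transition function of `Q` is the minimal transition function
for the transformed rates. As the minimal transition function is one with the given rates,
simplicity forces `p` to be minimal. -/

theorem tendsto_of_le_of_sum_le {ι β : Type*} {l : Filter β} {F : Finset ι}
    {f g : ι → β → ℝ} {a : ι → ℝ} (hgf : ∀ i ∈ F, ∀ᶠ x in l, g i x ≤ f i x)
    (hg : ∀ i ∈ F, Tendsto (g i) l (𝓝 (a i))) (hsum : ∀ᶠ x in l, ∑ i ∈ F, f i x ≤ ∑ i ∈ F, a i)
    {i : ι} (hi : i ∈ F) : Tendsto (f i) l (𝓝 (a i)) := by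
  classical
  have hupper : Tendsto (fun x => ∑ j ∈ F, a j - ∑ j ∈ F.erase i, g j x) l (𝓝 (a i)) := by
    have hlim := (tendsto_finsetSum (F.erase i) fun j hj =>
      hg j (Finset.mem_of_mem_erase hj)).const_sub (∑ j ∈ F, a j)
    rwa [← Finset.add_sum_erase F a hi, add_sub_cancel_right,
      Finset.add_sum_erase F a hi] at hlim
  refine tendsto_of_tendsto_of_tendsto_of_le_of_le' (hg i hi) hupper (hgf i hi) ?_
  filter_upwards [hsum, (Finset.eventually_all F).2 hgf] with x hx hgfx
  have herase : ∑ j ∈ F.erase i, g j x ≤ ∑ j ∈ F.erase i, f j x :=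
    Finset.sum_le_sum fun j hj => hgfx j (Finset.mem_of_mem_erase hj)
  linarith [Finset.add_sum_erase F (fun j => f j x) hi]

/-! ### Exponentials of matrices with nonnegative off-diagonal entries -/

/-- A Metzler matrix: all entries off the diagonal are nonnegative. The index type may be infinite,
so that the notion also applies to generators of Markov chains with countably many states. -/
def IsMetzler {α : Type*} (A : Matrix α α ℝ) : Prop :=
  ∀ ⦃i j⦄, i ≠ j → 0 ≤ A i j

section MetzlerExponential

open NormedSpace
open scoped Matrix

theorem IsMetzler.submatrix {α β : Type*} {A : Matrix α α ℝ} (hA : IsMetzler A) {f : β → α}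
    (hf : Function.Injective f) : IsMetzler (A.submatrix f f) :=
  fun _ _ hij => hA (hf.ne hij)

theorem IsMetzler.smul {α : Type*} {A : Matrix α α ℝ} (hA : IsMetzler A) {c : ℝ} (hc : 0 ≤ c) :
    IsMetzler (c • A) :=
  fun _ _ hij => mul_nonneg hc (hA hij)

theorem IsMetzler.exists_add_smul_one_nonneg {α : Type*} [Finite α] [DecidableEq α]
    {A : Matrix α α ℝ} (hA : IsMetzler A) :
    ∃ c : ℝ, ∀ i j, 0 ≤ (A + c • (1 : Matrix α α ℝ)) i j := by
  obtain ⟨c, hc⟩ := (Set.finite_range fun i => -A i i).bddAbove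
  refine ⟨c, fun i j => ?_⟩
  rcases eq_or_ne i j with rfl | hij
  · simpa using neg_le_iff_add_nonneg'.1 (hc ⟨i, rfl⟩)
  · simpa [hij] using hA hij

variable {ι κ : Type*} [Fintype ι] [DecidableEq ι] [Fintype κ] [DecidableEq κ]

theorem hasSum_matrix_exp_apply (A : Matrix ι ι ℝ) (i j : ι) :
    HasSum (fun m : ℕ => (m.factorial : ℝ)⁻¹ * (A ^ m) i j) (exp A i j) := by
  have h : HasSum (fun m : ℕ => (m.factorial : ℝ)⁻¹ • A ^ m) (exp A) := by
    open scoped Matrix.Norms.Operator in exact exp_series_hasSum_exp' (𝕂 := ℝ) A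
  exact h.map (Matrix.entryAddMonoidHom ℝ i j) (continuous_id.matrix_elem i j)

theorem hasDerivAt_matrix_exp_smul_apply (A : Matrix ι ι ℝ) (t : ℝ) (i j : ι) :
    HasDerivAt (fun u : ℝ => exp (u • A) i j) ((exp (t • A) * A) i j) t := by
  open scoped Matrix.Norms.Operator in
  exact (Matrix.entryLinearMap ℝ ℝ i j).toContinuousLinearMap.hasFDerivAt.comp_hasDerivAt t
    (hasDerivAt_exp_smul_const A t)

theorem matrix_exp_add_smul_one (A : Matrix ι ι ℝ) (c : ℝ) :
    exp (A + c • (1 : Matrix ι ι ℝ)) = Real.exp c • exp A := by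
  have hscalar : exp (c • (1 : Matrix ι ι ℝ)) = Real.exp c • (1 : Matrix ι ι ℝ) := by
    rw [Matrix.smul_one_eq_diagonal, Matrix.exp_diagonal, Matrix.smul_one_eq_diagonal,
      Real.exp_eq_exp_ℝ]
    exact congrArg Matrix.diagonal (funext (Pi.coe_exp _))
  rw [Matrix.exp_add_of_commute _ _ ((Commute.one_right A).smul_right c), hscalar,
    mul_smul_comm, mul_one]

theorem IsMetzler.exp_apply_nonneg {A : Matrix ι ι ℝ} (hA : IsMetzler A) (i j : ι) :
    0 ≤ exp A i j := by
  obtain ⟨c, hc⟩ := hA.exists_add_smul_one_nonneg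
  have hshift : 0 ≤ exp (A + c • (1 : Matrix ι ι ℝ)) i j :=
    (hasSum_matrix_exp_apply _ i j).nonneg fun m =>
      mul_nonneg (by positivity) (Matrix.pow_apply_nonneg hc m i j)
  rw [matrix_exp_add_smul_one] at hshift
  exact nonneg_of_mul_nonneg_right hshift (Real.exp_pos c)

theorem matrix_pow_submatrix_apply_le {A : Matrix κ κ ℝ} (hA : ∀ i j, 0 ≤ A i j) {f : ι → κ}
    (hf : Function.Injective f) (m : ℕ) (i j : ι) :
    (A.submatrix f f ^ m) i j ≤ (A ^ m) (f i) (f j) := by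
  induction m generalizing j with
  | zero => simp [Matrix.one_apply, hf.eq_iff]
  | succ m ih =>
    rw [pow_succ, pow_succ, Matrix.mul_apply, Matrix.mul_apply]
    calc ∑ x, (A.submatrix f f ^ m) i x * A (f x) (f j)
        ≤ ∑ x, (A ^ m) (f i) (f x) * A (f x) (f j) :=
          Finset.sum_le_sum fun x _ => mul_le_mul_of_nonneg_right (ih x) (hA _ _)
      _ = ∑ y ∈ Finset.univ.map ⟨f, hf⟩, (A ^ m) (f i) y * A y (f j) := by
          rw [Finset.sum_map, Function.Embedding.coeFn_mk]
      _ ≤ ∑ y, (A ^ m) (f i) y * A y (f j) :=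
          Finset.sum_le_sum_of_subset_of_nonneg (Finset.subset_univ _) fun y _ _ =>
            mul_nonneg (Matrix.pow_apply_nonneg hA m _ _) (hA _ _)

theorem IsMetzler.exp_submatrix_apply_le {A : Matrix κ κ ℝ} (hA : IsMetzler A) {f : ι → κ}
    (hf : Function.Injective f) (i j : ι) :
    exp (A.submatrix f f) i j ≤ exp A (f i) (f j) := by
  obtain ⟨c, hc⟩ := hA.exists_add_smul_one_nonneg
  have hsub : (A + c • (1 : Matrix κ κ ℝ)).submatrix f f =
      A.submatrix f f + c • (1 : Matrix ι ι ℝ) := by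
    rw [Matrix.submatrix_add, Matrix.submatrix_smul, Pi.add_apply, Pi.add_apply, Pi.smul_apply,
      Pi.smul_apply, Matrix.submatrix_one f hf]
  have hshift : exp (A.submatrix f f + c • (1 : Matrix ι ι ℝ)) i j ≤
      exp (A + c • (1 : Matrix κ κ ℝ)) (f i) (f j) :=
    hasSum_le (fun m => mul_le_mul_of_nonneg_left
        (hsub ▸ matrix_pow_submatrix_apply_le hc hf m i j) (by positivity))
      (hasSum_matrix_exp_apply _ i j) (hasSum_matrix_exp_apply _ (f i) (f j))
  rw [matrix_exp_add_smul_one, matrix_exp_add_smul_one] at hshift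
  exact le_of_mul_le_mul_left hshift (Real.exp_pos c)

/- `exp (t A) w` is nonincreasing in `t ≥ 0`, since its derivative is `exp (t A) (A w)`. -/
theorem IsMetzler.exp_mulVec_le {A : Matrix ι ι ℝ} (hA : IsMetzler A) {w : ι → ℝ}
    (hw : A *ᵥ w ≤ 0) : exp A *ᵥ w ≤ w := by
  intro i
  have hderiv (t : ℝ) :
      HasDerivAt (fun u : ℝ => (exp (u • A) *ᵥ w) i) ((exp (t • A) *ᵥ (A *ᵥ w)) i) t := by
    rw [Matrix.mulVec_mulVec]
    exact HasDerivAt.fun_sum fun j _ =>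
      (hasDerivAt_matrix_exp_smul_apply A t i j).mul_const (w j)
  have hanti : AntitoneOn (fun u : ℝ => (exp (u • A) *ᵥ w) i) (Set.Ici 0) := by
    refine antitoneOn_of_deriv_nonpos (convex_Ici 0)
      (fun t _ => (hderiv t).continuousAt.continuousWithinAt)
      (fun t _ => (hderiv t).differentiableAt.differentiableWithinAt) fun t ht => ?_
    rw [interior_Ici] at ht
    rw [(hderiv t).deriv]
    exact Finset.sum_nonpos fun j _ =>
      mul_nonpos_of_nonneg_of_nonpos ((hA.smul (le_of_lt ht)).exp_apply_nonneg i j) (hw j)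
  simpa using hanti (Set.mem_Ici.2 le_rfl) (Set.mem_Ici.2 zero_le_one) zero_le_one

end MetzlerExponential

/-! ### Doob transforms -/

/-- The Doob `h`-transform `D⁻¹ A D` of a matrix of transition rates or probabilities, where `D` is
the diagonal matrix of `h`. It is given by entries because infinite matrices have no product. -/
noncomputable def doobTransform {α : Type*} (h : α → ℝ) (A : Matrix α α ℝ) : Matrix α α ℝ :=
  Matrix.of fun i j => h j / h i * A i j

theorem doobTransform_smul {α : Type*} (h : α → ℝ) (c : ℝ) (A : Matrix α α ℝ) :
    doobTransform h (c • A) = c • doobTransform h A := by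
  ext i j
  exact mul_left_comm _ _ _

theorem exp_doobTransform {ι : Type*} [Fintype ι] [DecidableEq ι] {h : ι → ℝ}
    (hh : ∀ i, h i ≠ 0) (A : Matrix ι ι ℝ) :
    NormedSpace.exp (doobTransform h A) = doobTransform h (NormedSpace.exp A) := by
  let D : (Matrix ι ι ℝ)ˣ :=
    { val := Matrix.diagonal h
      inv := Matrix.diagonal fun i => (h i)⁻¹
      val_inv := by simp [hh]
      inv_val := by simp [hh] }
  have hconj (B : Matrix ι ι ℝ) :
      doobTransform h B = (↑D⁻¹ : Matrix ι ι ℝ) * B * (↑D : Matrix ι ι ℝ) := by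
    ext i j
    simp only [doobTransform, Matrix.of_apply, D, Units.inv_mk, Matrix.mul_diagonal,
      Matrix.diagonal_mul]
    ring
  rw [hconj, hconj, Matrix.exp_units_conj']

/-! ### The minimal transition function of a Q-matrix -/

/-- A Q-matrix: the rates of a Markov chain on `α`, possibly with killing. Summability of the rows
is expressed by bounds on finite partial sums. -/
structure IsQMatrix {α : Type*} (Q : Matrix α α ℝ) : Prop where
  isMetzler : IsMetzler Q
  sum_row_nonpos : ∀ (S : Finset α), ∀ i ∈ S, ∑ j ∈ S, Q i j ≤ 0

/-- The truncation of `Q` to a finite set `S` of states: transitions out of `S` become killing. -/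
def truncation {α : Type*} (Q : Matrix α α ℝ) (S : Finset α) : Matrix S S ℝ :=
  Q.submatrix Subtype.val Subtype.val

theorem IsMetzler.truncation {α : Type*} {Q : Matrix α α ℝ} (hQ : IsMetzler Q) (S : Finset α) :
    IsMetzler (truncation Q S) :=
  hQ.submatrix Subtype.val_injective

section MinimalTransition

variable {α : Type*} [DecidableEq α]

/-- The transition function of the chain with rates `Q` killed on leaving the finite set `S`. -/
noncomputable def killedTransition (Q : Matrix α α ℝ) (S : Finset α) (t : ℝ) : Matrix α α ℝ :=
  Matrix.of fun k n => if h : k ∈ S ∧ n ∈ S then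
    NormedSpace.exp (t • truncation Q S) ⟨k, h.1⟩ ⟨n, h.2⟩ else 0

/-- The minimal transition function with rates `Q`, that of the chain killed at explosion. As a
supremum of real numbers it is meaningful only when the killed transition functions are bounded,
which they are when `Q` is a Q-matrix and `0 ≤ t`. -/
noncomputable def minimalTransition (Q : Matrix α α ℝ) (t : ℝ) : Matrix α α ℝ :=
  Matrix.of fun k n => ⨆ S : Finset α, killedTransition Q S t k n

variable {Q : Matrix α α ℝ} {S : Finset α} {s t : ℝ} {k n : α}

theorem killedTransition_of_mem (hk : k ∈ S) (hn : n ∈ S) (t : ℝ) :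
    killedTransition Q S t k n =
      NormedSpace.exp (t • truncation Q S) ⟨k, hk⟩ ⟨n, hn⟩ :=
  dif_pos ⟨hk, hn⟩

theorem killedTransition_of_notMem_left (hk : k ∉ S) (t : ℝ) (n : α) :
    killedTransition Q S t k n = 0 :=
  dif_neg fun h => hk h.1

theorem killedTransition_of_notMem_right (hn : n ∉ S) (t : ℝ) (k : α) :
    killedTransition Q S t k n = 0 :=
  dif_neg fun h => hn h.2

theorem killedTransition_zero (hk : k ∈ S) (n : α) :
    killedTransition Q S 0 k n = (1 : Matrix α α ℝ) k n := by
  by_cases hn : n ∈ S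
  · simp [killedTransition_of_mem hk hn, Matrix.one_apply]
  · rw [killedTransition_of_notMem_right hn, Matrix.one_apply_ne (ne_of_mem_of_not_mem hk hn)]

theorem killedTransition_add (Q : Matrix α α ℝ) (S : Finset α) (s t : ℝ) (k n : α) :
    killedTransition Q S (s + t) k n =
      ∑ j ∈ S, killedTransition Q S s k j * killedTransition Q S t j n := by
  by_cases hk : k ∈ S
  · by_cases hn : n ∈ S
    · rw [killedTransition_of_mem hk hn, add_smul, Matrix.exp_add_of_commute _ _
        (((Commute.refl _).smul_left _).smul_right _), Matrix.mul_apply, ← Finset.sum_coe_sort S]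
      refine Finset.sum_congr rfl fun j _ => ?_
      rw [killedTransition_of_mem hk j.2, killedTransition_of_mem j.2 hn]
    · simp [killedTransition_of_notMem_right hn]
  · simp [killedTransition_of_notMem_left hk]

theorem tendsto_killedTransition_sub_one_div (hk : k ∈ S) (hn : n ∈ S) :
    Tendsto (fun t : ℝ => (killedTransition Q S t k n - (1 : Matrix α α ℝ) k n) / t) (𝓝[>] 0)
      (𝓝 (Q k n)) := by
  have hslope := (hasDerivAt_matrix_exp_smul_apply (truncation Q S) 0 ⟨k, hk⟩
    ⟨n, hn⟩).tendsto_slope_zero_right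
  have hentry : truncation Q S ⟨k, hk⟩ ⟨n, hn⟩ = Q k n := rfl
  simpa [div_eq_inv_mul, Matrix.one_apply, killedTransition_of_mem hk hn, hentry] using hslope

theorem killedTransition_nonneg (hQ : IsMetzler Q) (S : Finset α) (ht : 0 ≤ t) (k n : α) :
    0 ≤ killedTransition Q S t k n := by
  by_cases h : k ∈ S ∧ n ∈ S
  · rw [killedTransition_of_mem h.1 h.2]
    exact ((hQ.truncation _).smul ht).exp_apply_nonneg _ _
  · exact ge_of_eq (show killedTransition Q S t k n = 0 from dif_neg h)

theorem killedTransition_mono (hQ : IsMetzler Q) (ht : 0 ≤ t) (k n : α) :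
    Monotone fun S : Finset α => killedTransition Q S t k n := by
  intro S T hST
  by_cases h : k ∈ S ∧ n ∈ S
  · simp only [killedTransition_of_mem h.1 h.2, killedTransition_of_mem (hST h.1) (hST h.2)]
    exact ((hQ.truncation _).smul ht).exp_submatrix_apply_le
      (Set.inclusion_injective hST) ⟨k, h.1⟩ ⟨n, h.2⟩
  · exact (dif_neg h).trans_le (killedTransition_nonneg hQ T ht k n)

theorem sum_killedTransition_le_one (hQ : IsQMatrix Q) (S F : Finset α) (ht : 0 ≤ t) (k : α) :
    ∑ n ∈ F, killedTransition Q S t k n ≤ 1 := by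
  by_cases hk : k ∈ S
  · have hrow : (t • truncation Q S).mulVec 1 ≤ 0 := fun i => by
      have hsum := hQ.sum_row_nonpos S i i.2
      rw [← Finset.sum_coe_sort] at hsum
      simpa [truncation, Matrix.mulVec, dotProduct, ← Finset.mul_sum] using
        mul_nonpos_of_nonneg_of_nonpos ht hsum
    calc ∑ n ∈ F, killedTransition Q S t k n
        ≤ ∑ n ∈ F ∪ S, killedTransition Q S t k n :=
          Finset.sum_le_sum_of_subset_of_nonneg Finset.subset_union_left fun n _ _ =>
            killedTransition_nonneg hQ.isMetzler S ht k n
      _ = ∑ n ∈ S, killedTransition Q S t k n :=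
          (Finset.sum_subset Finset.subset_union_right fun n _ hn =>
            killedTransition_of_notMem_right hn t k).symm
      _ = (NormedSpace.exp (t • truncation Q S)).mulVec 1 ⟨k, hk⟩ := by
          simp [← Finset.sum_coe_sort S, killedTransition_of_mem hk, Matrix.mulVec, dotProduct]
      _ ≤ 1 := ((hQ.isMetzler.truncation S).smul ht).exp_mulVec_le hrow ⟨k, hk⟩
  · simp [killedTransition_of_notMem_left hk]

theorem killedTransition_doobTransform {h : α → ℝ} (hh : ∀ i, h i ≠ 0) (Q : Matrix α α ℝ)
    (S : Finset α) (t : ℝ) :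
    killedTransition (doobTransform h Q) S t = doobTransform h (killedTransition Q S t) := by
  ext k n
  simp only [doobTransform, Matrix.of_apply]
  by_cases hkn : k ∈ S ∧ n ∈ S
  · have hexp := exp_doobTransform (h := fun i : S => h i) (fun i => hh i)
      (t • truncation Q S)
    rw [doobTransform_smul] at hexp
    rw [killedTransition_of_mem hkn.1 hkn.2, killedTransition_of_mem hkn.1 hkn.2]
    exact congrFun₂ hexp ⟨k, hkn.1⟩ ⟨n, hkn.2⟩
  · simp [killedTransition, hkn]

theorem minimalTransition_doobTransform {h : α → ℝ} (hh : ∀ i, 0 < h i) (Q : Matrix α α ℝ)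
    (t : ℝ) :
    minimalTransition (doobTransform h Q) t = doobTransform h (minimalTransition Q t) := by
  ext k n
  simp only [minimalTransition, killedTransition_doobTransform fun i => (hh i).ne']
  exact (Real.mul_iSup_of_nonneg (div_pos (hh n) (hh k)).le _).symm

theorem tendsto_killedTransition (hQ : IsQMatrix Q) (ht : 0 ≤ t) (k n : α) :
    Tendsto (fun S : Finset α => killedTransition Q S t k n) atTop
      (𝓝 (minimalTransition Q t k n)) := by
  refine tendsto_atTop_ciSup (killedTransition_mono hQ.isMetzler ht k n) ⟨1, ?_⟩
  rintro _ ⟨S, rfl⟩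
  simpa using sum_killedTransition_le_one hQ S {n} ht k

theorem killedTransition_le_minimalTransition (hQ : IsQMatrix Q) (S : Finset α) (ht : 0 ≤ t)
    (k n : α) : killedTransition Q S t k n ≤ minimalTransition Q t k n :=
  (killedTransition_mono hQ.isMetzler ht k n).ge_of_tendsto (tendsto_killedTransition hQ ht k n) S

theorem minimalTransition_nonneg (hQ : IsQMatrix Q) (ht : 0 ≤ t) (k n : α) :
    0 ≤ minimalTransition Q t k n :=
  ge_of_tendsto' (tendsto_killedTransition hQ ht k n) fun S =>
    killedTransition_nonneg hQ.isMetzler S ht k n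

theorem sum_minimalTransition_le_one (hQ : IsQMatrix Q) (F : Finset α) (ht : 0 ≤ t) (k : α) :
    ∑ n ∈ F, minimalTransition Q t k n ≤ 1 :=
  le_of_tendsto' (tendsto_finsetSum F fun n _ => tendsto_killedTransition hQ ht k n) fun S =>
    sum_killedTransition_le_one hQ S F ht k

theorem summable_minimalTransition (hQ : IsQMatrix Q) (ht : 0 ≤ t) (k : α) :
    Summable fun n => minimalTransition Q t k n :=
  summable_of_sum_le (minimalTransition_nonneg hQ ht k) fun F =>
    sum_minimalTransition_le_one hQ F ht k

theorem minimalTransition_le_one (hQ : IsQMatrix Q) (ht : 0 ≤ t) (k n : α) :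
    minimalTransition Q t k n ≤ 1 := by
  simpa using sum_minimalTransition_le_one hQ {n} ht k

theorem minimalTransition_zero (hQ : IsQMatrix Q) : minimalTransition Q 0 = 1 := by
  ext k n
  refine tendsto_nhds_unique (tendsto_killedTransition hQ le_rfl k n)
    (tendsto_const_nhds.congr' ?_)
  filter_upwards [eventually_ge_atTop {k}] with S hS
  exact (killedTransition_zero (Finset.singleton_subset_iff.1 hS) n).symm

theorem summable_minimalTransition_mul (hQ : IsQMatrix Q) (hs : 0 ≤ s) (ht : 0 ≤ t) (k n : α) :
    Summable fun j => minimalTransition Q s k j * minimalTransition Q t j n :=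
  (summable_minimalTransition hQ hs k).of_nonneg_of_le
    (fun j => mul_nonneg (minimalTransition_nonneg hQ hs k j) (minimalTransition_nonneg hQ ht j n))
    fun j => mul_le_of_le_one_right (minimalTransition_nonneg hQ hs k j)
      (minimalTransition_le_one hQ ht j n)

theorem hasSum_minimalTransition_add (hQ : IsQMatrix Q) (hs : 0 ≤ s) (ht : 0 ≤ t) (k n : α) :
    HasSum (fun j => minimalTransition Q s k j * minimalTransition Q t j n)
      (minimalTransition Q (s + t) k n) := by
  have hsummable := summable_minimalTransition_mul hQ hs ht k n
  have hbound (S : Finset α) (j : α) : ‖killedTransition Q S s k j * killedTransition Q S t j n‖ ≤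
      minimalTransition Q s k j * minimalTransition Q t j n := by
    have hs0 := killedTransition_nonneg hQ.isMetzler S hs k j
    have ht0 := killedTransition_nonneg hQ.isMetzler S ht j n
    rw [Real.norm_of_nonneg (mul_nonneg hs0 ht0)]
    exact mul_le_mul (killedTransition_le_minimalTransition hQ S hs k j)
      (killedTransition_le_minimalTransition hQ S ht j n) ht0 (minimalTransition_nonneg hQ hs k j)
  have hlim : Tendsto
      (fun S : Finset α => ∑' j, killedTransition Q S s k j * killedTransition Q S t j n) atTop
      (𝓝 (∑' j, minimalTransition Q s k j * minimalTransition Q t j n)) :=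
    tendsto_tsum_of_dominated_convergence hsummable
      (fun j => (tendsto_killedTransition hQ hs k j).mul (tendsto_killedTransition hQ ht j n))
      (Eventually.of_forall hbound)
  have hkilled (S : Finset α) : killedTransition Q S (s + t) k n =
      ∑' j, killedTransition Q S s k j * killedTransition Q S t j n := by
    rw [killedTransition_add, tsum_eq_sum]
    exact fun j hj => by rw [killedTransition_of_notMem_right hj, zero_mul]
  have heq := tendsto_nhds_unique hlim
    ((tendsto_killedTransition hQ (add_nonneg hs ht) k n).congr hkilled)
  exact heq ▸ hsummable.hasSum

theorem tendsto_minimalTransition_sub_one_div (hQ : IsQMatrix Q) {F : Finset α} (hk : k ∈ F)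
    (hF : ∑ j ∈ F, Q k j = 0) (hn : n ∈ F) :
    Tendsto (fun t : ℝ => (minimalTransition Q t k n - (1 : Matrix α α ℝ) k n) / t) (𝓝[>] 0)
      (𝓝 (Q k n)) := by
  refine tendsto_of_le_of_sum_le (F := F)
    (f := fun j t => (minimalTransition Q t k j - (1 : Matrix α α ℝ) k j) / t)
    (g := fun j t => (killedTransition Q F t k j - (1 : Matrix α α ℝ) k j) / t)
    (fun j _ => ?_) (fun j hj => tendsto_killedTransition_sub_one_div hk hj) ?_ hn
  · filter_upwards [self_mem_nhdsWithin] with t (ht : 0 < t)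
    gcongr
    exact killedTransition_le_minimalTransition hQ F ht.le k j
  · filter_upwards [self_mem_nhdsWithin] with t (ht : 0 < t)
    have hone : ∑ j ∈ F, (1 : Matrix α α ℝ) k j = 1 := by simp [Matrix.one_apply, hk]
    rw [hF, ← Finset.sum_div, Finset.sum_sub_distrib, hone]
    exact div_nonpos_of_nonpos_of_nonneg
      (sub_nonpos.2 (sum_minimalTransition_le_one hQ F ht.le k)) ht.le

end MinimalTransition

/-! ### Birth-and-death processes -/

/-- The generator of the birth-and-death process on `ℤ` with birth rates `lam` and death rates
`mu`. -/
def birthDeathGenerator (lam mu : ℤ → ℝ) : Matrix ℤ ℤ ℝ :=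
  Matrix.of fun i j => (if j = i + 1 then lam i else 0) + (if j = i - 1 then mu i else 0) -
    (if j = i then lam i + mu i else 0)

section BirthDeath

variable {lam mu nu : ℤ → ℝ} {p q : ℝ → ℤ → ℤ → ℝ}

theorem birthDeathGenerator_apply_add_one (lam mu : ℤ → ℝ) (n : ℤ) :
    birthDeathGenerator lam mu n (n + 1) = lam n := by
  simp [birthDeathGenerator, show n + 1 ≠ n - 1 by lia]

theorem birthDeathGenerator_apply_sub_one (lam mu : ℤ → ℝ) (n : ℤ) :
    birthDeathGenerator lam mu n (n - 1) = mu n := by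
  simp [birthDeathGenerator, show n - 1 ≠ n + 1 by lia]

theorem birthDeathGenerator_apply_self (lam mu : ℤ → ℝ) (n : ℤ) :
    birthDeathGenerator lam mu n n = -(lam n + mu n) := by
  simp [birthDeathGenerator, show n ≠ n - 1 by lia]

theorem sum_birthDeathGenerator_row (lam mu : ℤ → ℝ) (n : ℤ) :
    ∑ j ∈ {n + 1, n - 1, n}, birthDeathGenerator lam mu n j = 0 := by
  rw [Finset.sum_insert (by simp; lia), Finset.sum_insert (by simp), Finset.sum_singleton,
    birthDeathGenerator_apply_add_one, birthDeathGenerator_apply_sub_one,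
    birthDeathGenerator_apply_self]
  ring

theorem isQMatrix_birthDeathGenerator (hlam : ∀ n, 0 ≤ lam n) (hmu : ∀ n, 0 ≤ mu n) :
    IsQMatrix (birthDeathGenerator lam mu) where
  isMetzler i j hij := by
    simp only [birthDeathGenerator, Matrix.of_apply, if_neg hij.symm, sub_zero]
    exact add_nonneg (ite_nonneg (hlam i) le_rfl) (ite_nonneg (hmu i) le_rfl)
  sum_row_nonpos S i hi := by
    simp only [birthDeathGenerator, Matrix.of_apply, Finset.sum_sub_distrib,
      Finset.sum_add_distrib, Finset.sum_ite_eq', if_pos hi]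
    exact sub_nonpos.2 (add_le_add (ite_le_sup _ _ _ |>.trans (sup_le le_rfl (hlam i)))
      (ite_le_sup _ _ _ |>.trans (sup_le le_rfl (hmu i))))

theorem isBirthDeathTransition_minimalTransition (hlam : ∀ n, 0 ≤ lam n) (hmu : ∀ n, 0 ≤ mu n) :
    IsBirthDeathTransition lam mu (minimalTransition (birthDeathGenerator lam mu)) := by
  have hQ := isQMatrix_birthDeathGenerator hlam hmu
  have hrate (n : ℤ) {j : ℤ} (hj : j ∈ ({n + 1, n - 1, n} : Finset ℤ)) :=
    tendsto_minimalTransition_sub_one_div hQ (by simp) (sum_birthDeathGenerator_row lam mu n) hj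
  exact
    { nonneg := fun t ht => minimalTransition_nonneg hQ ht
      summable_row := fun t ht => summable_minimalTransition hQ ht
      row_le_one := fun t ht k => (summable_minimalTransition hQ ht k).tsum_le_of_sum_le fun F =>
        sum_minimalTransition_le_one hQ F ht k
      initial := fun k n => by simp [minimalTransition_zero hQ, Matrix.one_apply, eq_comm]
      chapman_kolmogorov := fun s t hs ht => hasSum_minimalTransition_add hQ hs ht
      birth_rate := fun n => by
        simpa [birthDeathGenerator_apply_add_one] using hrate n (j := n + 1) (by simp)
      death_rate := fun n => by
        simpa [birthDeathGenerator_apply_sub_one, Matrix.one_apply, show n ≠ n - 1 by lia] using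
          hrate n (j := n - 1) (by simp)
      exit_rate := fun n => by
        simpa [birthDeathGenerator_apply_self, ← neg_div] using (hrate n (j := n) (by simp)).neg }

theorem IsBirthDeathTransition.birth_nonneg (hp : IsBirthDeathTransition lam mu p) (n : ℤ) :
    0 ≤ lam n :=
  ge_of_tendsto (hp.birth_rate n) <| by
    filter_upwards [self_mem_nhdsWithin] with δ (hδ : 0 < δ)
    exact div_nonneg (hp.nonneg δ hδ.le n (n + 1)) hδ.le

theorem IsBirthDeathTransition.death_nonneg (hp : IsBirthDeathTransition lam mu p) (n : ℤ) :
    0 ≤ mu n :=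
  ge_of_tendsto (hp.death_rate n) <| by
    filter_upwards [self_mem_nhdsWithin] with δ (hδ : 0 < δ)
    exact div_nonneg (hp.nonneg δ hδ.le n (n - 1)) hδ.le

theorem IsBirthDeathTransition.congr (hp : IsBirthDeathTransition lam mu p)
    (hpq : ∀ t, 0 ≤ t → p t = q t) : IsBirthDeathTransition lam mu q := by
  have hlim {φ : (ℤ → ℤ → ℝ) → ℝ → ℝ} {l : Filter ℝ}
      (h : Tendsto (fun δ => φ (p δ) δ) (𝓝[>] 0) l) : Tendsto (fun δ => φ (q δ) δ) (𝓝[>] 0) l :=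
    h.congr' <| by
      filter_upwards [self_mem_nhdsWithin] with δ (hδ : 0 < δ)
      rw [hpq δ hδ.le]
  exact
    { nonneg := fun t ht => hpq t ht ▸ hp.nonneg t ht
      summable_row := fun t ht => hpq t ht ▸ hp.summable_row t ht
      row_le_one := fun t ht => hpq t ht ▸ hp.row_le_one t ht
      initial := hpq 0 le_rfl ▸ hp.initial
      chapman_kolmogorov := fun s t hs ht => by
        rw [← hpq s hs, ← hpq t ht, ← hpq (s + t) (add_nonneg hs ht)]
        exact hp.chapman_kolmogorov s t hs ht
      birth_rate := fun n => hlim (φ := fun P δ => P n (n + 1) / δ) (hp.birth_rate n)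
      death_rate := fun n => hlim (φ := fun P δ => P n (n - 1) / δ) (hp.death_rate n)
      exit_rate := fun n => hlim (φ := fun P δ => (1 - P n n) / δ) (hp.exit_rate n) }

theorem transformedBirth_add_transformedDeath {n : ℤ} (hn : nu n ≠ 0)
    (hharm : nu (n + 1) * lam n - nu n * (lam n + mu n) + nu (n - 1) * mu n = 0) :
    transformedBirth lam nu n + transformedDeath mu nu n = lam n + mu n := by
  unfold transformedBirth transformedDeath
  field_simp
  linarith

theorem birthDeathGenerator_transformed (hnu : ∀ n, nu n ≠ 0)
    (hharm : ∀ n : ℤ, nu (n + 1) * lam n - nu n * (lam n + mu n) + nu (n - 1) * mu n = 0) :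
    birthDeathGenerator (transformedBirth lam nu) (transformedDeath mu nu) =
      doobTransform nu (birthDeathGenerator lam mu) := by
  ext i j
  have hbirth : (if j = i + 1 then transformedBirth lam nu i else 0) =
      nu j / nu i * (if j = i + 1 then lam i else 0) := by
    split_ifs with h <;> simp [h, transformedBirth, mul_comm]
  have hdeath : (if j = i - 1 then transformedDeath mu nu i else 0) =
      nu j / nu i * (if j = i - 1 then mu i else 0) := by
    split_ifs with h <;> simp [h, transformedDeath, mul_comm]
  have hexit : (if j = i then transformedBirth lam nu i + transformedDeath mu nu i else 0) =
      nu j / nu i * (if j = i then lam i + mu i else 0) := by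
    rw [transformedBirth_add_transformedDeath (hnu i) (hharm i)]
    split_ifs with h <;> simp [h, hnu i]
  simp only [birthDeathGenerator, doobTransform, Matrix.of_apply, hbirth, hdeath, hexit]
  ring

theorem isBirthDeathTransition_doobTransform_minimalTransition (hlam : ∀ n, 0 ≤ lam n)
    (hmu : ∀ n, 0 ≤ mu n) (hnu : ∀ n, 0 < nu n)
    (hharm : ∀ n : ℤ, nu (n + 1) * lam n - nu n * (lam n + mu n) + nu (n - 1) * mu n = 0) :
    IsBirthDeathTransition (transformedBirth lam nu) (transformedDeath mu nu)
      (fun t => doobTransform nu (minimalTransition (birthDeathGenerator lam mu) t)) := by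
  simp only [← minimalTransition_doobTransform hnu,
    ← birthDeathGenerator_transformed (fun n => (hnu n).ne') hharm]
  exact isBirthDeathTransition_minimalTransition
    (fun n => mul_nonneg (hlam n) (div_pos (hnu _) (hnu n)).le)
    fun n => mul_nonneg (hmu n) (div_pos (hnu _) (hnu n)).le

end BirthDeath

theorem theorem1_general (lam mu : ℤ → ℝ) (p : ℝ → ℤ → ℤ → ℝ)
    (hp : IsBirthDeathTransition lam mu p) (hsimple : IsSimpleBirthDeath lam mu)
    (nu : ℤ → ℝ) (hnu : ∀ n, 0 < nu n)
    (hharm : ∀ n : ℤ, nu (n + 1) * lam n - nu n * (lam n + mu n) + nu (n - 1) * mu n = 0) :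
    IsBirthDeathTransition (transformedBirth lam nu) (transformedDeath mu nu)
        (fun t k n => nu n / nu k * p t k n) ∧
      (IsSimpleBirthDeath (transformedBirth lam nu) (transformedDeath mu nu) →
        ∀ p' : ℝ → ℤ → ℤ → ℝ,
          IsBirthDeathTransition (transformedBirth lam nu) (transformedDeath mu nu) p' →
          ∀ t : ℝ, 0 ≤ t → ∀ k n : ℤ, p' t k n = nu n / nu k * p t k n) := by
  have hminimal := hsimple p _ hp
    (isBirthDeathTransition_minimalTransition hp.birth_nonneg hp.death_nonneg)
  have htransform : IsBirthDeathTransition (transformedBirth lam nu) (transformedDeath mu nu)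
      (fun t k n => nu n / nu k * p t k n) :=
    (isBirthDeathTransition_doobTransform_minimalTransition hp.birth_nonneg hp.death_nonneg hnu
      hharm).congr fun t ht => by
        ext k n
        simp only [doobTransform, Matrix.of_apply, hminimal t ht]
  exact ⟨htransform, fun hsimple' p' hp' => hsimple' p' _ hp' htransform⟩

theorem theorem1 (lam mu : ℤ → ℝ) (hlam : ∀ n, 0 < lam n) (hmu : ∀ n, 0 < mu n)
    (p : ℝ → ℤ → ℤ → ℝ) (hp : IsBirthDeathTransition lam mu p)
    (hsimple : IsSimpleBirthDeath lam mu)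
    (nu : ℤ → ℝ) (hnu : ∀ n, 0 < nu n) (hmono : StrictMono nu ∨ StrictAnti nu)
    (hharm : ∀ n : ℤ, nu (n + 1) * lam n - nu n * (lam n + mu n) + nu (n - 1) * mu n = 0) :
    IsBirthDeathTransition (transformedBirth lam nu) (transformedDeath mu nu)
        (fun t k n => nu n / nu k * p t k n) ∧
      (IsSimpleBirthDeath (transformedBirth lam nu) (transformedDeath mu nu) →
        ∀ p' : ℝ → ℤ → ℤ → ℝ,
          IsBirthDeathTransition (transformedBirth lam nu) (transformedDeath mu nu) p' →
          ∀ t : ℝ, 0 ≤ t → ∀ k n : ℤ, p' t k n = nu n / nu k * p t k n) :=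
  theorem1_general lam mu p hp hsimple nu hnu hharm
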